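/- A Lawvere theory is a category $\mathcal{T}$ with finite products whose objects are listed as $T_0,T_1,T_2,\dots$, together with, for each $n\in\mathbb{N}$, specified projections $\pi_{n,i}\colon T_n\to T_1$ ($1\le i\le n$) making $T_n$ an $n$-fold power of $T_1$. For a category $\mathcal{C}$ let $\mathsf{Alg}(\mathcal{T},\mathcal{C})$ be the category of finite product preserving functors $\mathcal{T}\to\mathcal{C}$ and natural transformations, with underlying functor $|-|_{\mathcal{C}}\colon\mathsf{Alg}(\mathcal{T},\mathcal{C})\to\mathcal{C}$, $\mathsf{A}\mapsto\mathsf{A}(T_1)$; let $\mathsf{Coalg}(\mathcal{T},\mathcal{C})=\mathsf{Alg}(\mathcal{T},\mathcal{C}^{\mathsf{op}})^{\mathsf{op}}$, with underlying functor $\|-\|\colon\mathsf{Coalg}(\mathcal{T},\mathcal{C})\to\mathcal{C}$, again evaluation at $T_1$. Let $\mathcal{C}$ be a locally presentable category and $\mathcal{T}$ a (small) Lawvere theory. Then $\mathsf{Alg}(\mathcal{T},\mathcal{C})$ has finite coproducts, the functor $|-|_{\mathcal{C}}$ has a left adjoint, and for every left adjoint $F\colon\mathcal{C}\to\mathsf{Alg}(\mathcal{T},\mathcal{C})$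 of $|-|_{\mathcal{C}}$ (the free algebra functor) there exists a functor $T\colon\mathcal{C}\to\mathsf{Coalg}(\mathcal{T},\mathsf{Alg}(\mathcal{T},\mathcal{C}))$ such that $\|-\|\circ T=F$ and $T$ has a right adjoint. -/

import Mathlib

open CategoryTheory CategoryTheory.Limits

universe w v v' u u'

/-- A Lawvere theory: a category with finite products whose objects are listed as
`pow 0, pow 1, pow 2, …`, together with, for every `n`, specified projections exhibiting `pow n`
as the `n`-fold power of `pow 1`. -/
class LawvereTheory (T : Type u) [Category.{v} T] where
  /-- The list of objects `T₀, T₁, T₂, …`. -/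
  pow : ℕ → T
  pow_surjective : Function.Surjective pow
  hasFiniteProducts : HasFiniteProducts T
  /-- The specified projections `Tₙ ⟶ T₁`. -/
  proj (n : ℕ) : Fin n → (pow n ⟶ pow 1)
  /-- The specified projections form a product cone. -/
  isProduct (n : ℕ) : IsLimit (Fan.mk (pow n) (proj n))

namespace LawvereTheory

/-- The property of a functor `T ⥤ C` of preserving finite products. -/
def isAlgebra (T : Type u) [Category.{v} T] (C : Type u') [Category.{v'} C] :
    ObjectProperty (T ⥤ C) :=
  fun A => PreservesFiniteProducts A

/-- The category `Alg(T, C)` of internal `T`-algebras in `C`: finite product preserving functors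
`T ⥤ C` and all natural transformations between them. -/
abbrev Alg (T : Type u) [Category.{v} T] (C : Type u') [Category.{v'} C] :=
  (isAlgebra T C).FullSubcategory

/-- The underlying functor `Alg(T, C) ⥤ C`: evaluation at the object `T₁`. -/
def algForget (T : Type u) [Category.{v} T] [LawvereTheory T]
    (C : Type u') [Category.{v'} C] : Alg T C ⥤ C :=
  (isAlgebra T C).ι ⋙ (evaluation T C).obj (pow 1)

/-- The category `Coalg(T, D) = Alg(T, Dᵒᵖ)ᵒᵖ` of internal `T`-coalgebras in `D`. -/
abbrev Coalg (T : Type u) [Category.{v} T] (D : Type u') [Category.{v'} D] :=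
  (Alg T Dᵒᵖ)ᵒᵖ

/-- The underlying functor `Coalg(T, D) ⥤ D`, the opposite of `Alg(T, Dᵒᵖ) ⥤ Dᵒᵖ`. -/
def coalgForget (T : Type u) [Category.{v} T] [LawvereTheory T]
    (D : Type u') [Category.{v'} D] : Coalg T D ⥤ D :=
  (algForget T Dᵒᵖ).leftOp

end LawvereTheory

/-! Preserving finite products is orthogonality to a small set of maps between presentable objects
of `T ⥤ C`. Hence `Alg T C` is reflective there, so it is cocomplete and each evaluation at `x` has
a left adjoint `L x` (`isRightAdjoint_algEvaluation_obj`). Conjugation makes `x ↦ L x X` a functor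
`T ⥤ (Alg T C)ᵒᵖ`. Since Hom(`L x X`, `B`) ≅ Hom(`X`, `B x`) and `B` preserves finite products, so
does this functor: it is a coalgebra with underlying object `L T₁ X`. Colimits in `X` are preserved
because each `L x` preserves them, and local presentability of `C` then yields the right adjoint. -/

namespace CategoryTheory

/-! ### Adjoint functor theorem -/

/-- A colimit preserving functor out of a locally presentable category is a left adjoint. -/
theorem IsLocallyPresentable.isLeftAdjoint_of_preservesColimits
    {C : Type u} [Category.{w} C] [IsLocallyPresentable.{w} C]
    {D : Type u'} [Category.{w} D] (F : C ⥤ D) [PreservesColimitsOfSize.{w, w} F] :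
    F.IsLeftAdjoint := by
  obtain ⟨κ, _, _⟩ := IsLocallyPresentable.exists_cardinal.{w} C
  obtain ⟨P, _, hP⟩ := HasCardinalFilteredGenerator.exists_small_generator C κ
  have : PreservesLimitsOfSize.{w, w} F.op := preservesLimitsOfSize_op F
  have : F.op.IsRightAdjoint := by
    refine isRightAdjoint_of_preservesLimits_of_solutionSetCondition F.op fun R ↦ ?_
    -- One object suffices as solution set: the colimit of all generators `G` equipped with a map
    -- from `F G` to `R.unop`.
    let S := CostructuredArrow (P.ι ⋙ F) R.unop
    have : EssentiallySmall.{w} P.FullSubcategory :=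
      essentiallySmall_of_small_of_locallySmall _
    have : HasColimitsOfShape S C :=
      hasColimitsOfShape_of_equivalence (equivSmallModel.{w} S).symm
    have : PreservesColimitsOfShape S F :=
      preservesColimitsOfShape_of_equiv (equivSmallModel.{w} S).symm F
    let Φ : S ⥤ C := CostructuredArrow.proj (P.ι ⋙ F) R.unop ⋙ P.ι
    let c : Cocone (Φ ⋙ F) :=
      { pt := R.unop
        ι := { app := fun s ↦ s.hom
               naturality := fun _ _ f ↦ (CostructuredArrow.w f).trans (Category.comp_id _).symm } }
    let hΦ := isColimitOfPreserves F (colimit.isColimit Φ)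
    have hdesc (s : S) : F.map (colimit.ι Φ s) ≫ hΦ.desc c = s.hom := hΦ.fac c s
    refine ⟨PUnit, fun _ ↦ .op (colimit Φ), fun _ ↦ (hΦ.desc c).op, fun X h ↦ ?_⟩
    obtain ⟨J, _, _, ⟨p⟩⟩ := hP.exists_colimitsOfShape X.unop
    -- Restricting `h` along a presentation of `X` by generators lands in `S`, which gives the map
    -- from `X` to `colimit Φ`.
    let Ψ : J ⥤ S :=
      { obj := fun j ↦ CostructuredArrow.mk
          (Y := (⟨p.diag.obj j, p.prop_diag_obj j⟩ : P.FullSubcategory))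
          (F.map (p.ι.app j) ≫ h.unop)
        map := fun f ↦ CostructuredArrow.homMk (P.homMk (p.diag.map f)) (by
          simp [← Functor.map_comp_assoc]) }
    let d : Cocone p.diag :=
      { pt := colimit Φ
        ι := { app := fun j ↦ colimit.ι Φ (Ψ.obj j)
               naturality := fun _ _ f ↦ 
                 (colimit.w Φ (Ψ.map f)).trans (Category.comp_id _).symm } }
    refine ⟨⟨⟩, (p.isColimit.desc d).op, Quiver.Hom.unop_inj ?_⟩
    refine (isColimitOfPreserves F p.isColimit).hom_ext fun j ↦ ?_
    have := p.isColimit.fac d j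
    dsimp at this ⊢
    rw [← Functor.map_comp_assoc, this]
    exact hdesc (Ψ.obj j)
  exact ⟨_, ⟨(Adjunction.ofIsRightAdjoint F.op).unop⟩⟩

/-! ### Algebras as local objects -/

section

variable {C : Type u} [Category.{v} C]

/-- If every object is a colimit of objects satisfying `P`, the universal property of a product
can be tested on objects satisfying `P`. -/
theorem Limits.Fan.nonempty_isLimit_of_colimitsOfShape {P : ObjectProperty C}
    (hP : ∀ X, ∃ (J : Type w) (_ : SmallCategory J), P.colimitsOfShape J X)
    {ι : Type u'} {Y : ι → C} (c : Fan Y)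
    (hc : ∀ G, P G → Function.Bijective fun (a : G ⟶ c.pt) (i : ι) ↦ a ≫ c.proj i) :
    Nonempty (IsLimit c) := by
  have huniq {X : C} (a b : X ⟶ c.pt) (h : ∀ i, a ≫ c.proj i = b ≫ c.proj i) : a = b := by
    obtain ⟨J, _, ⟨p⟩⟩ := hP X
    exact p.isColimit.hom_ext fun j ↦ (hc _ (p.prop_diag_obj j)).1 (by ext i; simp [h i])
  have hlift {X : C} (a : ∀ i, X ⟶ Y i) : ∃ l : X ⟶ c.pt, ∀ i, l ≫ c.proj i = a i := by
    obtain ⟨J, _, ⟨p⟩⟩ := hP X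
    choose l hl using fun j ↦ (hc _ (p.prop_diag_obj j)).2 fun i ↦ p.ι.app j ≫ a i
    replace hl (j i) : l j ≫ c.proj i = p.ι.app j ≫ a i := congrFun (hl j) i
    -- The lifts on the pieces form a cocone because lifts are unique.
    refine ⟨p.isColimit.desc ⟨c.pt, { app := l, naturality := fun j k f ↦ ?_ }⟩, fun i ↦ ?_⟩
    · exact huniq _ _ fun i ↦ by simp [hl]
    · exact p.isColimit.hom_ext fun j ↦ by rw [p.isColimit.fac_assoc, hl]
  choose l hl using @hlift
  exact ⟨Fan.IsLimit.mk c (fun s ↦ l s.proj) (fun s i ↦ hl _ i)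
    fun s m hm ↦ huniq _ _ fun i ↦ by rw [hl, hm]⟩

/-- A functor preserves finite products if and only if it maps chosen products to products. -/
theorem preservesFiniteProducts_iff_nonempty_isLimit {T : Type u'} [Category.{v'} T]
    [HasFiniteProducts T] (A : T ⥤ C) :
    PreservesFiniteProducts A ↔ ∀ (n : ℕ) (f : Fin n → T),
      Nonempty (IsLimit (Fan.mk (A.obj (∏ᶜ f)) fun i ↦ A.map (Pi.π f i))) := by
  refine ⟨fun _ n f ↦ ⟨isLimitFanMkObjOfIsLimit A f _ (productIsProduct f)⟩, fun h ↦ ⟨fun n ↦ ?_⟩⟩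
  have (f : Fin n → T) : PreservesLimit (Discrete.functor f) A :=
    preservesLimit_of_preserves_limit_cone (productIsProduct f)
      ((isLimitMapConeFanMkEquiv A f _).symm (h n f).some)
  exact preservesLimitsOfShape_of_discrete A

end

section

variable {C : Type u} [Category.{w} C] [HasCoproducts.{w} C]
  {T : Type w} [SmallCategory T] [HasFiniteProducts T]

/-- Orthogonality to this morphism says that a functor sees the product of the `f i` as a product
when tested on `G`. -/
noncomputable def productComparison {n : ℕ} (f : Fin n → T) (G : C) :
    (∐ fun i ↦ (evaluationLeftAdjoint C (f i)).obj G) ⟶ (evaluationLeftAdjoint C (∏ᶜ f)).obj G :=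
  Limits.Sigma.desc fun i ↦ ((evaluationAdjunctionRight C (f i)).homEquiv G
      ((evaluationLeftAdjoint C (∏ᶜ f)).obj G)).symm
    ((evaluationAdjunctionRight C (∏ᶜ f)).unit.app G ≫
      ((evaluationLeftAdjoint C (∏ᶜ f)).obj G).map (Pi.π f i))

/-- Maps out of a finite coproduct of representable functors. -/
noncomputable def sigmaEvaluationHomEquiv {n : ℕ} (f : Fin n → T) (G : C) (A : T ⥤ C) :
    ((∐ fun i ↦ (evaluationLeftAdjoint C (f i)).obj G) ⟶ A) ≃ ∀ i, G ⟶ A.obj (f i) where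
  toFun u i := (evaluationAdjunctionRight C (f i)).homEquiv G A
    (Limits.Sigma.ι (fun i ↦ (evaluationLeftAdjoint C (f i)).obj G) i ≫ u)
  invFun a := Limits.Sigma.desc fun i ↦ ((evaluationAdjunctionRight C (f i)).homEquiv G A).symm (a i)
  left_inv u := by
    refine Limits.Sigma.hom_ext _ _ fun i ↦ ?_
    rw [Limits.Sigma.ι_desc, Equiv.symm_apply_apply]
  right_inv a := by
    funext i
    beta_reduce
    rw [Limits.Sigma.ι_desc, Equiv.apply_symm_apply]

theorem sigmaEvaluationHomEquiv_productComparison_comp {n : ℕ} (f : Fin n → T) (G : C) (A : T ⥤ C)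
    (u : (evaluationLeftAdjoint C (∏ᶜ f)).obj G ⟶ A) (i : Fin n) :
    sigmaEvaluationHomEquiv f G A (productComparison f G ≫ u) i =
      (evaluationAdjunctionRight C (∏ᶜ f)).homEquiv G A u ≫ A.map (Pi.π f i) := by
  dsimp only [sigmaEvaluationHomEquiv, productComparison, Equiv.coe_fn_mk]
  rw [Limits.Sigma.ι_desc_assoc, Adjunction.homEquiv_naturality_right, Equiv.apply_symm_apply,
    Adjunction.homEquiv_unit, Category.assoc, Category.assoc]
  congr 1
  exact u.naturality _

theorem bijective_productComparison_comp_iff {n : ℕ} (f : Fin n → T) (G : C) (A : T ⥤ C) :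
    Function.Bijective (fun u : _ ⟶ A ↦ productComparison f G ≫ u) ↔
      Function.Bijective fun (a : G ⟶ A.obj (∏ᶜ f)) (i : Fin n) ↦ a ≫ A.map (Pi.π f i) := by
  rw [← Equiv.comp_bijective _ (sigmaEvaluationHomEquiv f G A),
    ← Equiv.bijective_comp ((evaluationAdjunctionRight C (∏ᶜ f)).homEquiv G A)]
  refine iff_of_eq (congrArg _ ?_)
  funext u i
  exact sigmaEvaluationHomEquiv_productComparison_comp f G A u i

variable (T) in
/-- The comparison morphisms tested on objects satisfying `P`. -/
def productComparisons (P : ObjectProperty C) : MorphismProperty (T ⥤ C) :=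
  .ofHoms fun x : (Σ n : ℕ, Fin n → T) × P.FullSubcategory ↦ productComparison x.1.2 x.2.obj

instance (P : ObjectProperty C) [ObjectProperty.Small.{w} P] :
    MorphismProperty.IsSmall.{w} (productComparisons T P) := by
  unfold productComparisons
  infer_instance

theorem isLocal_productComparisons_iff {P : ObjectProperty C}
    (hP : ∀ X, ∃ (J : Type w) (_ : SmallCategory J), P.colimitsOfShape J X) (A : T ⥤ C) :
    (productComparisons T P).isLocal A ↔ PreservesFiniteProducts A := by
  rw [preservesFiniteProducts_iff_nonempty_isLimit]
  refine ⟨fun h n f ↦ ?_, fun h ↦ ?_⟩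
  · exact Fan.nonempty_isLimit_of_colimitsOfShape hP _ fun G hG ↦
      (bijective_productComparison_comp_iff f G A).1
        (h _ ⟨(⟨⟨n, f⟩, ⟨G, hG⟩⟩ : (Σ n : ℕ, Fin n → T) × P.FullSubcategory)⟩)
  · rintro _ _ _ ⟨⟨⟨n, f⟩, G⟩⟩
    obtain ⟨hl⟩ := h n f
    refine (bijective_productComparison_comp_iff f G.obj A).2 ⟨fun a b hab ↦ ?_, fun a ↦ ?_⟩
    · exact Fan.IsLimit.hom_ext hl _ _ fun i ↦ congrFun hab i
    · exact ⟨Fan.IsLimit.lift hl a, funext fun i ↦ Fan.IsLimit.fac hl a i⟩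

/-- Left adjoints of evaluations preserve κ-presentability, and finite coproducts do too since κ is
infinite. This is the size condition for reflectivity of the local objects. -/
theorem isCardinalPresentable_of_productComparisons {κ : Cardinal.{w}} [Fact κ.IsRegular]
    [HasColimitsOfSize.{w, w} C]
    {P : ObjectProperty C} (hP : P ≤ isCardinalPresentable C κ) {X Y : T ⥤ C} (g : X ⟶ Y)
    (hg : productComparisons T P g) : IsCardinalPresentable X κ ∧ IsCardinalPresentable Y κ := by
  obtain ⟨⟨⟨n, f⟩, G⟩⟩ := hg
  have : IsCardinalPresentable G.obj κ := hP _ G.property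
  have hpres (x : T) : IsCardinalPresentable ((evaluationLeftAdjoint C x).obj G.obj) κ :=
    (evaluationAdjunctionRight C x).isCardinalPresentable_leftAdjoint_obj κ G.obj
  refine ⟨?_, hpres _⟩
  have (k : Discrete (Fin n)) : IsCardinalPresentable
    ((Discrete.functor fun i ↦ (evaluationLeftAdjoint C (f i)).obj G.obj).obj k) κ := hpres _
  exact isCardinalPresentable_of_isColimit _ (coproductIsCoproduct _) κ
    (hasCardinalLT_of_finite _ _ (Cardinal.IsRegular.aleph0_le Fact.out))

end

end CategoryTheory

namespace LawvereTheory

variable {C : Type u} [Category.{w} C] [IsLocallyPresentable.{w} C]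
  (T : Type w) [SmallCategory.{w} T] [LawvereTheory T]

theorem isRightAdjoint_isAlgebra_ι : (isAlgebra T C).ι.IsRightAdjoint := by
  have : HasFiniteProducts T := hasFiniteProducts
  obtain ⟨κ, _, _⟩ := IsLocallyPresentable.exists_cardinal.{w} C
  obtain ⟨P, _, hP⟩ := HasCardinalFilteredGenerator.exists_small_generator C κ
  have heq : isAlgebra T C = (productComparisons T P).isLocal := by
    ext A
    refine (isLocal_productComparisons_iff (fun X ↦ ?_) A).symm
    obtain ⟨J, _, _, h⟩ := hP.exists_colimitsOfShape X
    exact ⟨J, _, h⟩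
  rw [heq]
  exact MorphismProperty.isRightAdjoint_ι_isLocal _ κ
    fun _ _ ↦ isCardinalPresentable_of_productComparisons hP.le_isCardinalPresentable

end LawvereTheory

/-! ### Left adjoints varying with a parameter -/

namespace CategoryTheory

open Opposite

section

variable {T : Type u} [Category.{v} T] {A : Type u'} [Category.{w} A]

/-- Passing to conjugates is compatible with the hom-set bijections of adjunctions. -/
theorem homEquiv_conjugateEquiv_symm_comp {C : Type*} [Category* C] {L₁ L₂ : C ⥤ A}
    {R₁ R₂ : A ⥤ C} (adj₁ : L₁ ⊣ R₁) (adj₂ : L₂ ⊣ R₂) (α : R₁ ⟶ R₂) {X : C} {B : A}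
    (u : L₁.obj X ⟶ B) :
    adj₂.homEquiv X B (((conjugateEquiv adj₁ adj₂).symm α).app X ≫ u) =
      adj₁.homEquiv X B u ≫ α.app B := by
  rw [Adjunction.homEquiv_unit, Adjunction.homEquiv_unit, Functor.map_comp,
    ← Category.assoc (adj₂.unit.app X), ← unit_conjugateEquiv_symm, Category.assoc, Category.assoc,
    NatTrans.naturality]

/-- A functor to an opposite category preserves limits of a given shape as soon as all its
composites with representable functors do. -/
theorem preservesLimitsOfShape_of_comp_yoneda (K : T ⥤ Aᵒᵖ) (J : Type*) [Category* J]
    (h : ∀ X : A, PreservesLimitsOfShape J (K ⋙ yoneda.obj X)) : PreservesLimitsOfShape J K where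
  preservesLimit := ⟨fun hc ↦ ⟨yonedaJointlyReflectsLimits _ _ fun X ↦
    isLimitOfPreserves (K ⋙ yoneda.obj X) hc⟩⟩

end

section

variable {T : Type u} [Category.{v} T] {A : Type u'} [Category.{w} A] {C : Type*} [Category.{w} C]
  (R : T ⥤ A ⥤ C) {L : T → C ⥤ A} (adj : ∀ x, L x ⊣ R.obj x)

/-- Left adjoints of a family of functors are contravariantly functorial in the parameter. -/
def parametrizedLeftAdjoints : T ⥤ (C ⥤ A)ᵒᵖ where
  obj x := op (L x)
  map f := ((conjugateEquiv (adj _) (adj _)).symm (R.map f)).op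
  map_id x := by simp
  map_comp f g := by
    rw [R.map_comp, ← conjugateEquiv_symm_comp (adj _) (adj _) (adj _), op_comp]

/-- The functor sending `X` to the family of the values at `X` of left adjoints of a family of
functors. -/
def leftAdjointsValues : Cᵒᵖ ⥤ T ⥤ Aᵒᵖ where
  obj X := parametrizedLeftAdjoints R adj ⋙ ((evaluation C A).obj X.unop).op
  map g :=
    { app := fun x ↦ ((L x).map g.unop).op
      naturality := fun _ _ f ↦ Quiver.Hom.unop_inj
        (((conjugateEquiv (adj _) (adj _)).symm (R.map f)).naturality g.unop) }

/-- Homomorphisms out of the values of left adjoints. -/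
def leftAdjointsValuesCompYonedaIso (X : Cᵒᵖ) (B : A) :
    (leftAdjointsValues R adj).obj X ⋙ yoneda.obj B ≅ R.flip.obj B ⋙ coyoneda.obj X :=
  NatIso.ofComponents (fun x ↦ ((adj x).homEquiv X.unop B).toIso) fun {x y} f ↦ by
    ext u
    exact homEquiv_conjugateEquiv_symm_comp (adj x) (adj y) (R.map f) u

theorem preservesLimitsOfSize_leftAdjointsValues :
    PreservesLimitsOfSize.{w, w} (leftAdjointsValues R adj) := by
  refine preservesLimits_of_evaluation _ fun x ↦ ?_
  have : PreservesColimitsOfSize.{w, w} (L x) := (adj x).leftAdjoint_preservesColimits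
  have : PreservesLimitsOfSize.{w, w} (L x).op := preservesLimitsOfSize_op (L x)
  exact inferInstanceAs (PreservesLimitsOfSize.{w, w} (L x).op)

end

end CategoryTheory

/-! ### The free coalgebra functor -/

namespace LawvereTheory

open Opposite

variable {C : Type u} [Category.{w} C]
  (T : Type w) [SmallCategory.{w} T]

variable (C) in
/-- Evaluation of algebras, as a functor of the object at which one evaluates. -/
abbrev algEvaluation : T ⥤ Alg T C ⥤ C :=
  evaluation T C ⋙ (Functor.whiskeringLeft _ _ _).obj (isAlgebra T C).ι

section

variable {T} {L : T → C ⥤ Alg T C} (adj : ∀ x, L x ⊣ (algEvaluation C T).obj x)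

theorem isAlgebra_leftAdjointsValues (X : Cᵒᵖ) :
    isAlgebra T (Alg T C)ᵒᵖ ((leftAdjointsValues (algEvaluation C T) adj).obj X) :=
  ⟨fun n ↦ preservesLimitsOfShape_of_comp_yoneda _ _ fun B ↦ by
    have : PreservesFiniteProducts B.obj := B.property
    have : PreservesLimitsOfShape (Discrete (Fin n))
        ((algEvaluation C T).flip.obj B ⋙ coyoneda.obj X) :=
      inferInstanceAs (PreservesLimitsOfShape _ (B.obj ⋙ coyoneda.obj X))
    exact preservesLimitsOfShape_of_natIso
      (leftAdjointsValuesCompYonedaIso (algEvaluation C T) adj X B).symm⟩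

/-- The coalgebra structure on free algebras. -/
def freeCoalgebra : C ⥤ Coalg T (Alg T C) :=
  ((isAlgebra T (Alg T C)ᵒᵖ).lift (leftAdjointsValues (algEvaluation C T) adj)
    (isAlgebra_leftAdjointsValues adj)).rightOp

theorem freeCoalgebra_comp_coalgForget [LawvereTheory T] :
    freeCoalgebra adj ⋙ coalgForget T (Alg T C) = L (pow 1) :=
  rfl

/-- The fully faithful inclusion of algebras reflects limits, so the check reduces to functors into
`(Alg T C)ᵒᵖ`, where limits are pointwise. -/
theorem preservesColimitsOfSize_freeCoalgebra :
    PreservesColimitsOfSize.{w, w} (freeCoalgebra adj) := by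
  have : PreservesLimitsOfSize.{w, w} ((isAlgebra T (Alg T C)ᵒᵖ).lift _
      (isAlgebra_leftAdjointsValues adj) ⋙ (isAlgebra T (Alg T C)ᵒᵖ).ι) :=
    preservesLimitsOfSize_leftAdjointsValues (algEvaluation C T) adj
  have := preservesLimits_of_reflects_of_preserves ((isAlgebra T (Alg T C)ᵒᵖ).lift _
      (isAlgebra_leftAdjointsValues adj)) (isAlgebra T (Alg T C)ᵒᵖ).ι
  exact preservesColimitsOfSize_rightOp _

end

variable [IsLocallyPresentable.{w} C] [LawvereTheory T]

instance : HasColimitsOfSize.{w, w} (Alg T C) := by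
  obtain ⟨κ, _, _⟩ := IsLocallyPresentable.exists_cardinal.{w} C
  have := isRightAdjoint_isAlgebra_ι (C := C) T
  let : Reflective (isAlgebra T C).ι := ⟨_, Adjunction.ofIsRightAdjoint _⟩
  exact hasColimits_of_reflective (isAlgebra T C).ι

theorem isRightAdjoint_algEvaluation_obj (x : T) :
    ((algEvaluation C T).obj x).IsRightAdjoint := by
  obtain ⟨κ, _, _⟩ := IsLocallyPresentable.exists_cardinal.{w} C
  have := isRightAdjoint_isAlgebra_ι (C := C) T
  exact inferInstanceAs ((isAlgebra T C).ι ⋙ (evaluation T C).obj x).IsRightAdjoint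

end LawvereTheory

theorem proposition2
    {C : Type u} [Category.{w} C] [IsLocallyPresentable.{w} C]
    (T : Type w) [SmallCategory.{w} T] [LawvereTheory T] :
    HasFiniteCoproducts (LawvereTheory.Alg T C) ∧
    (LawvereTheory.algForget T C).IsRightAdjoint ∧
    ∀ (F : C ⥤ LawvereTheory.Alg T C), (F ⊣ LawvereTheory.algForget T C) →
      ∃ K : C ⥤ LawvereTheory.Coalg T (LawvereTheory.Alg T C),
        K ⋙ LawvereTheory.coalgForget T (LawvereTheory.Alg T C) = F ∧
        K.IsLeftAdjoint := by
  refine ⟨inferInstance, LawvereTheory.isRightAdjoint_algEvaluation_obj T _, fun F adj ↦ ?_⟩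
  have hadj (x : T) : ∃ (L : C ⥤ LawvereTheory.Alg T C)
      (_ : L ⊣ (LawvereTheory.algEvaluation C T).obj x), x = LawvereTheory.pow 1 → L = F := by
    -- Choosing the given `F` itself at `T₁` makes the underlying functor equal to `F`, not merely
    -- isomorphic.
    by_cases hx : x = LawvereTheory.pow 1
    · subst hx
      exact ⟨F, adj, fun _ ↦ rfl⟩
    · have := LawvereTheory.isRightAdjoint_algEvaluation_obj (C := C) T x
      exact ⟨_, .ofIsRightAdjoint _, fun h ↦ (hx h).elim⟩
  choose L adjL hL using hadj
  refine ⟨LawvereTheory.freeCoalgebra adjL,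
    (LawvereTheory.freeCoalgebra_comp_coalgForget adjL).trans (hL _ rfl), ?_⟩
  have := LawvereTheory.preservesColimitsOfSize_freeCoalgebra adjL
  exact IsLocallyPresentable.isLeftAdjoint_of_preservesColimits _
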